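/- All rings and algebras are commutative. Let $R$ be a ring and $n \ge 0$. An $R$-module $M$ is \emph{locally free of rank $n$} if the unit ideal of $R$ is generated by the elements $r\in R$ for which $M_r$ is free of rank $n$ over $R_r$; an $R$-algebra is \emph{of rank $n$} if it is locally free of rank $n$ as an $R$-module. The symmetric group $S_n$ acts on $A^{\otimes n}=A\otimes_R\cdots\otimes_R A$ by permuting the tensor factors; for a subgroup $G\subseteq S_n$ write $(A^{\otimes n})^G$ for the subalgebra of $G$-invariants. If $A$ is an $R$-algebra of rank $n$, the \emph{Ferrand homomorphism} $\Phi_{A/R}\colon (A^{\otimes n})^{S_n}\to R$ is the $R$-algebra homomorphism such that multiplication by $t\in (A^{\otimes n})^{S_n}$ on $A^{\otimes n}$ induces multiplication by $\Phi_{A/R}(t)$ on $\bigwedge^n_R A$. The homomorphisms $\Phi_{A/R}$ commute with base change and $\Phi_{A/R}(a\otimes\cdots\otimes a)$ is the norm of $a$, and these two properties characterize them. A \emph{closure datum} for $A$ over $R$ is a pair $(G,\varphi)$ consisting of a subgroup $G\subseteq S_n$ and an $R$-algebra homomorphism $\varphi\colon (A^{\otimes n})^G\to R$ whose restriction to $(A^{\otimes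 n})^{S_n}$ is $\Phi_{A/R}$. Its \emph{closure algebra} is the $R$-algebra \[ A^{\otimes n}\otimes_{(A^{\otimes n})^G} R \;\cong\; A^{\otimes n}/\bigl(\alpha-\varphi(\alpha) : \alpha\in (A^{\otimes n})^G\bigr). \] \textbf{Corollary.} Let $R$ be a ring and let $A$ be an étale $R$-algebra of rank $n$. Then for every closure datum $(G,\varphi)$ for $A$ over $R$, the associated closure algebra is an étale $R$-algebra of rank $|G|$. -/

import Mathlib

open scoped TensorProduct

universe u v

/-- An `R`-module `M` is locally free of rank `n` if the unit ideal of `R` is generated by the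
elements `r` for which `M_r` is free of rank `n` over `R_r`. -/
def IsLocallyFreeOfRank (R : Type u) [CommRing R] (M : Type v) [AddCommGroup M] [Module R M]
    (n : ℕ) : Prop :=
  Ideal.span {r : R | Nonempty (Module.Basis (Fin n) (Localization.Away r)
    (LocalizedModule.Away r M))} = ⊤

/-- The `n`-fold tensor power `A^{⊗ n}` of an `R`-algebra `A`, as a commutative `R`-algebra. -/
abbrev TPow (R : Type u) [CommRing R] (A : Type v) [CommRing A] [Algebra R A] (n : ℕ) :
    Type (max u v) :=
  ⨂[R] _ : Fin n, A

namespace TPow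

variable {R : Type u} [CommRing R] {A : Type v} [CommRing A] [Algebra R A] {n : ℕ}

/-- The action of a permutation `σ` on `A^{⊗ n}`: it moves the `i`-th factor to position `σ i`. -/
noncomputable def permute (σ : Equiv.Perm (Fin n)) : TPow R A n →ₐ[R] TPow R A n :=
  PiTensorProduct.liftAlgHom
    ((PiTensorProduct.tprod R : MultilinearMap R (fun _ : Fin n => A) _).domDomCongr σ.symm)
    rfl (fun x y => by
      simp only [MultilinearMap.domDomCongr_apply]
      rw [PiTensorProduct.tprod_mul_tprod]; rfl)

@[simp] theorem permute_tprod (σ : Equiv.Perm (Fin n)) (a : Fin n → A) :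
    permute σ (PiTensorProduct.tprod R a) = PiTensorProduct.tprod R (fun i => a (σ.symm i)) :=
  PiTensorProduct.lift.tprod _

end TPow

/-- The algebra of invariants `(A^{⊗ n})^G` for a subgroup `G` of the symmetric group `S_n`. -/
noncomputable def fixedPower (R : Type u) [CommRing R] (A : Type v) [CommRing A] [Algebra R A]
    {n : ℕ} (G : Subgroup (Equiv.Perm (Fin n))) : Subalgebra R (TPow R A n) where
  carrier := {t | ∀ σ ∈ G, TPow.permute σ t = t}
  mul_mem' := fun hx hy σ hσ => by rw [map_mul, hx σ hσ, hy σ hσ]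
  add_mem' := fun hx hy σ hσ => by rw [map_add, hx σ hσ, hy σ hσ]
  algebraMap_mem' := fun r σ _ => AlgHom.commutes _ r

theorem fixedPower_anti {R : Type u} [CommRing R] {A : Type v} [CommRing A] [Algebra R A]
    {n : ℕ} {G H : Subgroup (Equiv.Perm (Fin n))} (h : G ≤ H) :
    fixedPower R A H ≤ fixedPower R A G :=
  fun _ ht σ hσ => ht σ (h hσ)

/-- The canonical projection `A^{⊗ n} → ⋀^n A`,
`a₁ ⊗ ⋯ ⊗ aₙ ↦ a₁ ∧ ⋯ ∧ aₙ`. -/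
noncomputable def toWedge (R : Type u) [CommRing R] (A : Type v) [CommRing A] [Algebra R A]
    (n : ℕ) : TPow R A n →ₗ[R] ⋀[R]^n A :=
  PiTensorProduct.lift (exteriorPower.ιMulti R n (M := A)).toMultilinearMap

namespace Ferrand

open PiTensorProduct

variable {R : Type u} [CommRing R]

section Module

variable {M : Type v} [AddCommGroup M] [Module R M] {n : ℕ}

/-- Elements over which `M` is free of rank `n` up to multiplication by a scalar. -/
def splitSet (R : Type u) [CommRing R] (M : Type v) [AddCommGroup M] [Module R M] (n : ℕ) :
    Set R :=
  {s | ∃ (g : (Fin n → R) →ₗ[R] M) (f : M →ₗ[R] (Fin n → R)),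
    (∀ x, g (f x) = s • x) ∧ ∀ y, f (g y) = s • y}

theorem finitePresentation (h : IsLocallyFreeOfRank R M n) : Module.FinitePresentation R M := by
  refine Module.FinitePresentation.of_localizationSpan _ h ?_
  rintro ⟨r, ⟨b⟩⟩
  exact Module.FinitePresentation.of_equiv b.equivFun.symm

theorem pow_mem_splitSet (hfp : Module.FinitePresentation R M) (r : R)
    (b : Module.Basis (Fin n) (Localization.Away r) (LocalizedModule.Away r M)) :
    ∃ k : ℕ, r ^ k ∈ splitSet R M n := by
  classical
  let S := Submonoid.powers r
  let i : M →ₗ[R] LocalizedModule S M := LocalizedModule.mkLinearMap S M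
  let j : (Fin n → R) →ₗ[R] (Fin n → Localization S) :=
    LinearMap.pi fun k => (Algebra.linearMap R (Localization S)).comp (LinearMap.proj k)
  have hj : IsLocalizedModule S j := by
    have := IsLocalizedModule.pi S (fun _ : Fin n => Algebra.linearMap R (Localization S))
    exact this
  let e : LocalizedModule S M ≃ₗ[R] (Fin n → Localization S) := b.equivFun.restrictScalars R
  obtain ⟨f, s, hf⟩ := Module.FinitePresentation.exists_lift_of_isLocalizedModule S j
    (e.toLinearMap ∘ₗ i)
  obtain ⟨g, t, hg⟩ := Module.FinitePresentation.exists_lift_of_isLocalizedModule S i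
    (e.symm.toLinearMap ∘ₗ j)
  have hf' : ∀ x, j (f x) = s • e (i x) := fun x => congr($hf x)
  have hg' : ∀ y, i (g y) = t • e.symm (j y) := fun x => congr($hg x)
  have h1 : i ∘ₗ (g ∘ₗ f) = i ∘ₗ ((s * t) • LinearMap.id) := by
    ext x
    simp only [LinearMap.comp_apply, hg', hf', LinearMap.smul_apply, LinearMap.id_apply,
      LinearMap.map_smul_of_tower]
    rw [mul_comm, mul_smul, Submonoid.smul_def s (e (i x)), map_smul, LinearEquiv.symm_apply_apply]
    rfl
  have h2 : j ∘ₗ (f ∘ₗ g) = j ∘ₗ ((s * t) • LinearMap.id) := by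
    refine LinearMap.ext fun x => ?_
    simp only [LinearMap.comp_apply, hg', hf', LinearMap.smul_apply, LinearMap.id_apply,
      LinearMap.map_smul_of_tower]
    rw [mul_smul, Submonoid.smul_def t (e.symm (j x)), map_smul, LinearEquiv.apply_symm_apply]
    rfl
  obtain ⟨c, hc⟩ := Module.Finite.exists_smul_of_comp_eq_of_isLocalizedModule S i _ _ h1
  obtain ⟨d, hd⟩ := Module.Finite.exists_smul_of_comp_eq_of_isLocalizedModule S j _ _ h2
  obtain ⟨k, hk⟩ := (c * d * (s * t)).2
  refine ⟨k, g, ((c * d : S) : R) • f, fun x => ?_, fun y => ?_⟩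
  · have := congr($hc x)
    simp only [LinearMap.smul_apply, LinearMap.comp_apply, LinearMap.id_apply,
      Submonoid.smul_def] at this
    simp only [hk, LinearMap.smul_apply, map_smul, Submonoid.coe_mul] at this ⊢
    rw [mul_comm (c : R), mul_smul, this]
    simp only [smul_smul]
    congr 1; ring
  · have := congr($hd y)
    simp only [LinearMap.smul_apply, LinearMap.comp_apply, LinearMap.id_apply,
      Submonoid.smul_def] at this
    simp only [hk, LinearMap.smul_apply, Submonoid.coe_mul] at this ⊢
    rw [mul_smul, this]
    simp only [smul_smul]
    congr 1; ring

theorem span_splitSet (h : IsLocallyFreeOfRank R M n) : Ideal.span (splitSet R M n) = ⊤ := by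
  by_contra hne
  obtain ⟨m, hm, hle⟩ := Ideal.exists_le_maximal _ hne
  refine hm.ne_top (top_le_iff.1 ?_)
  rw [← h, Ideal.span_le]
  rintro r ⟨b⟩
  obtain ⟨k, hk⟩ := pow_mem_splitSet (finitePresentation h) r b
  exact hm.isPrime.mem_of_pow_mem k (hle (Ideal.subset_span hk))

theorem eq_zero_of_splitSet {N : Type*} [AddCommGroup N] [Module R N]
    (h : IsLocallyFreeOfRank R M n) (z : N) (k : ℕ)
    (hz : ∀ s ∈ splitSet R M n, s ^ k • z = 0) : z = 0 := by
  have h1 := Ideal.span_pow_eq_top _ (span_splitSet h) k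
  have h2 : Ideal.span ((· ^ k) '' splitSet R M n) ≤
      LinearMap.ker (LinearMap.toSpanSingleton R N z) := by
    rw [Ideal.span_le]
    rintro _ ⟨s, hs, rfl⟩
    simpa using hz s hs
  rw [h1] at h2
  simpa using h2 (Submodule.mem_top (x := (1 : R)))

theorem alternating_eq_det {N : Type*} [AddCommGroup N] [Module R N]
    (β : (Fin n → R) [⋀^Fin n]→ₗ[R] N) (v : Fin n → Fin n → R) :
    β v = (Pi.basisFun R (Fin n)).det v • β (Pi.basisFun R (Fin n)) := by
  have : β = (LinearMap.toSpanSingleton R N (β (Pi.basisFun R (Fin n)))).compAlternatingMap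
      (Pi.basisFun R (Fin n)).det := by
    refine Module.Basis.ext_alternating (Pi.basisFun R (Fin n)) fun i hi => ?_
    let σ : Equiv.Perm (Fin n) := Equiv.ofBijective i (Finite.injective_iff_bijective.1 hi)
    change β (Pi.basisFun R (Fin n) ∘ σ) = (Pi.basisFun R (Fin n)).det (Pi.basisFun R (Fin n) ∘ σ) • β (Pi.basisFun R (Fin n))
    simp only [AlternatingMap.map_perm, Module.Basis.det_self]
    simp
  exact congr($this v)

theorem pow_smul_alternating {N : Type*} [AddCommGroup N] [Module R N]
    (β : M [⋀^Fin n]→ₗ[R] N) (s : R) (g : (Fin n → R) →ₗ[R] M) (f : M →ₗ[R] (Fin n → R))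
    (hgf : ∀ x, g (f x) = s • x) (v : Fin n → M) :
    s ^ n • β v = (Pi.basisFun R (Fin n)).det (fun i => f (v i)) •
      β (fun i => g (Pi.basisFun R (Fin n) i)) := by
  have h1 := alternating_eq_det (β.compLinearMap g) (fun i => f (v i))
  simp only [AlternatingMap.compLinearMap_apply] at h1
  rw [← h1]
  simp only [hgf]
  rw [← AlternatingMap.coe_multilinearMap, MultilinearMap.map_smul_univ]
  simp

/-- Alternating `n`-forms on a module of rank `n` are proportional. -/
theorem alternating_mul_comm {N : Type*} [AddCommGroup N] [Module R N]
    (h : IsLocallyFreeOfRank R M n) (α : M [⋀^Fin n]→ₗ[R] R) (β : M [⋀^Fin n]→ₗ[R] N)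
    (v w : Fin n → M) : α v • β w = α w • β v := by
  rw [← sub_eq_zero]
  refine eq_zero_of_splitSet h _ (n + n) ?_
  rintro s ⟨g, f, hgf, -⟩
  have key : ∀ v w, s ^ (n + n) • α v • β w = (s ^ n • α v) • (s ^ n • β w) := by
    intro v w
    simp only [smul_eq_mul, smul_smul]; congr 1; ring
  rw [smul_sub, key, key, pow_smul_alternating α s g f hgf v, pow_smul_alternating β s g f hgf w,
    pow_smul_alternating α s g f hgf w, pow_smul_alternating β s g f hgf v, sub_eq_zero]
  simp only [smul_eq_mul, smul_smul]; congr 1; ring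

theorem span_alternating (h : IsLocallyFreeOfRank R M n) :
    Ideal.span {r : R | ∃ (α : M [⋀^Fin n]→ₗ[R] R) (v : Fin n → M), α v = r} = ⊤ := by
  have h1 := Ideal.span_pow_eq_top _ (span_splitSet h) n
  rw [eq_top_iff, ← h1, Ideal.span_le]
  rintro _ ⟨s, ⟨g, f, -, hfg⟩, rfl⟩
  refine Ideal.subset_span ⟨(Pi.basisFun R (Fin n)).det.compLinearMap f,
    fun i => g (Pi.basisFun R (Fin n) i), ?_⟩
  simp only [AlternatingMap.compLinearMap_apply, hfg]
  rw [← AlternatingMap.coe_multilinearMap, MultilinearMap.map_smul_univ]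
  simp only [AlternatingMap.coe_multilinearMap, Module.Basis.det_self]
  simp

/-- A tensor that is fixed by a transposition is killed by every alternating map. -/
theorem lift_eq_zero_of_swap {N : Type*} [AddCommGroup N] [Module R N]
    (h : IsLocallyFreeOfRank R M n) (β : M [⋀^Fin n]→ₗ[R] N) {i j : Fin n} (hij : i ≠ j)
    (y : ⨂[R] _ : Fin n, M)
    (hy : lift ((tprod R : MultilinearMap R (fun _ : Fin n => M) _).domDomCongr
      (Equiv.swap i j)) y = y) :
    lift β.toMultilinearMap y = 0 := by
  classical
  refine eq_zero_of_splitSet h _ n ?_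
  rintro s ⟨g, f, hgf, -⟩
  let b : Module.Basis (Fin n → Fin n) R (⨂[R] _ : Fin n, (Fin n → R)) :=
    Basis.piTensorProduct (fun _ => Pi.basisFun R (Fin n))
  let τ : (⨂[R] _ : Fin n, (Fin n → R)) →ₗ[R] (⨂[R] _ : Fin n, (Fin n → R)) :=
    lift ((tprod R : MultilinearMap R (fun _ : Fin n => (Fin n → R)) _).domDomCongr
      (Equiv.swap i j))
  let sw : (Fin n → Fin n) → (Fin n → Fin n) := fun p k => p (Equiv.swap i j k)
  have hsw : ∀ p, sw (sw p) = p := fun p => by funext k; simp [sw]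
  let z := PiTensorProduct.map (fun _ : Fin n => f) y
  have hz : τ z = z := by
    have : τ ∘ₗ PiTensorProduct.map (fun _ : Fin n => f) =
        PiTensorProduct.map (fun _ : Fin n => f) ∘ₗ
          lift ((tprod R : MultilinearMap R (fun _ : Fin n => M) _).domDomCongr
            (Equiv.swap i j)) := by
      ext v; simp [τ]
    have h2 := congr($this y)
    simp only [LinearMap.comp_apply, hy] at h2
    exact h2
  have hτb : ∀ p, τ (b p) = b (sw p) := fun p => by simp [τ, b, sw]
  have hcoef : ∀ p, b.repr z (sw p) = b.repr z p := by
    intro p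
    have h3 : ∀ x, b.repr (τ x) (sw p) = b.repr x p := by
      intro x
      have : (Finsupp.lapply (sw p) ∘ₗ b.repr.toLinearMap) ∘ₗ τ =
          Finsupp.lapply p ∘ₗ b.repr.toLinearMap := by
        refine b.ext fun q => ?_
        simp only [LinearMap.comp_apply, hτb, LinearEquiv.coe_coe, Module.Basis.repr_self,
          Finsupp.lapply_apply, Finsupp.single_apply]
        have : (sw q = sw p) ↔ q = p := ⟨fun h => by rw [← hsw q, h, hsw], fun h => by rw [h]⟩
        simp [this]
      exact congr($this x)
    conv_lhs => rw [← hz]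
    exact h3 z
  let γ : (Fin n → R) [⋀^Fin n]→ₗ[R] N := β.compLinearMap g
  have hγ : lift γ.toMultilinearMap z = 0 := by
    rw [← b.sum_repr z, map_sum]
    refine Finset.sum_involution (fun p _ => sw p) ?_ ?_ (fun _ _ => Finset.mem_univ _)
      (fun p _ => hsw p)
    · intro p _
      rw [map_smul, map_smul, hcoef, ← smul_add]
      have : lift γ.toMultilinearMap (b (sw p)) = - lift γ.toMultilinearMap (b p) := by
        simp only [b, Basis.piTensorProduct_apply, lift.tprod]
        exact γ.map_swap (fun k => Pi.basisFun R (Fin n) (p k)) hij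
      rw [this]; simp
    · intro p _ hp heq
      apply hp
      have hpij : p i = p j := by
        have := congrFun heq j
        simpa [sw] using this
      rw [map_smul]
      simp only [b, Basis.piTensorProduct_apply, lift.tprod]
      have : γ (fun k => Pi.basisFun R (Fin n) (p k)) = 0 :=
        γ.map_eq_zero_of_eq _ (by simp [hpij]) hij
      erw [this, smul_zero]
  have hfin : (lift γ.toMultilinearMap) ∘ₗ PiTensorProduct.map (fun _ : Fin n => f) =
      s ^ n • lift β.toMultilinearMap := by
    ext v
    simp only [LinearMap.compMultilinearMap_apply, LinearMap.comp_apply, map_tprod, lift.tprod,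
      LinearMap.smul_apply]
    change β (fun k => g (f (v k))) = s ^ n • β v
    simp only [hgf]
    rw [← AlternatingMap.coe_multilinearMap, MultilinearMap.map_smul_univ]
    simp
  have := congr($hfin y)
  simp only [LinearMap.comp_apply, LinearMap.smul_apply] at this
  rw [← this]
  exact hγ

end Module

section Algebra

variable {A : Type v} [CommRing A] [Algebra R A] {n : ℕ}

/-- For a symmetric tensor `t` and an alternating map `β`, the alternating map
`x ↦ β (t * x)`. -/
noncomputable def twist {N : Type*} [AddCommGroup N] [Module R N]
    (h : IsLocallyFreeOfRank R A n) (t : fixedPower R A (⊤ : Subgroup (Equiv.Perm (Fin n))))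
    (β : A [⋀^Fin n]→ₗ[R] N) : A [⋀^Fin n]→ₗ[R] N where
  toMultilinearMap :=
    (lift β.toMultilinearMap ∘ₗ LinearMap.mulLeft R (t : TPow R A n)).compMultilinearMap (tprod R)
  map_eq_zero_of_eq' := by
    intro v i j hv hij
    change lift β.toMultilinearMap ((t : TPow R A n) * tprod R v) = 0
    refine lift_eq_zero_of_swap h β hij _ ?_
    have h1 : TPow.permute (Equiv.swap i j) ((t : TPow R A n) * tprod R v) =
        (t : TPow R A n) * tprod R v := by
      rw [map_mul, t.2 _ (Subgroup.mem_top _), TPow.permute_tprod]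
      congr 2
      funext k
      rw [Equiv.symm_swap]
      by_cases hk : k = i
      · subst hk; simpa using hv.symm
      · by_cases hk' : k = j
        · subst hk'; simpa using hv
        · rw [Equiv.swap_apply_of_ne_of_ne hk hk']
    exact h1

theorem lift_twist {N : Type*} [AddCommGroup N] [Module R N]
    (h : IsLocallyFreeOfRank R A n) (t : fixedPower R A (⊤ : Subgroup (Equiv.Perm (Fin n))))
    (β : A [⋀^Fin n]→ₗ[R] N) (x : TPow R A n) :
    lift (twist h t β).toMultilinearMap x = lift β.toMultilinearMap ((t : TPow R A n) * x) := by
  have : lift (twist h t β).toMultilinearMap =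
      lift β.toMultilinearMap ∘ₗ LinearMap.mulLeft R (t : TPow R A n) := by
    ext v
    simp only [LinearMap.compMultilinearMap_apply, lift.tprod]
    rfl
  exact congr($this x)

theorem lift_mul_comm {N : Type*} [AddCommGroup N] [Module R N]
    (h : IsLocallyFreeOfRank R A n) (α : A [⋀^Fin n]→ₗ[R] R) (β : A [⋀^Fin n]→ₗ[R] N)
    (x y : TPow R A n) :
    lift α.toMultilinearMap x • lift β.toMultilinearMap y =
      lift α.toMultilinearMap y • lift β.toMultilinearMap x := by
  induction x using PiTensorProduct.induction_on with
  | smul_tprod r v =>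
    induction y using PiTensorProduct.induction_on with
    | smul_tprod r' w =>
      simp only [map_smul, lift.tprod, AlternatingMap.coe_multilinearMap]
      have h1 := alternating_mul_comm h α β v w
      rw [smul_assoc, smul_comm _ r', h1, smul_assoc, smul_comm (α w) r, smul_comm r r']
    | add x y hx hy => simp only [map_add, smul_add, add_smul, hx, hy]
  | add x y hx hy => simp only [map_add, smul_add, add_smul, hx, hy]

theorem eq_of_smul_wedge (h : IsLocallyFreeOfRank R A n) (r s : R)
    (hr : ∀ x : TPow R A n, r • toWedge R A n x = s • toWedge R A n x) : r = s := by
  have hle : Ideal.span {r : R | ∃ (α : A [⋀^Fin n]→ₗ[R] R) (v : Fin n → A), α v = r} ≤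
      LinearMap.ker (LinearMap.mulLeft R (r - s)) := by
    rw [Ideal.span_le]
    rintro _ ⟨α, v, rfl⟩
    have := congr(exteriorPower.alternatingMapLinearEquiv α $(hr (tprod R v)))
    simpa [toWedge, sub_mul, sub_eq_zero] using this
  rw [span_alternating h] at hle
  simpa [sub_eq_zero] using hle (Submodule.mem_top (x := (1 : R)))

/-- A symmetric tensor acts on the (invertible) module `⋀^n A` by a unique scalar. -/
theorem existsUnique_scalar (h : IsLocallyFreeOfRank R A n)
    (t : fixedPower R A (⊤ : Subgroup (Equiv.Perm (Fin n)))) :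
    ∃! r : R, ∀ x : TPow R A n,
      toWedge R A n ((t : TPow R A n) * x) = r • toWedge R A n x := by
  refine existsUnique_of_exists_of_unique ?_ ?_
  · let I : Ideal R :=
      { carrier := {c | ∃ r : R, ∀ x : TPow R A n,
          c • toWedge R A n ((t : TPow R A n) * x) = r • toWedge R A n x}
        add_mem' := by
          rintro a b ⟨r, hr⟩ ⟨s, hs⟩
          exact ⟨r + s, fun x => by rw [add_smul, add_smul, hr, hs]⟩
        zero_mem' := ⟨0, fun x => by simp⟩
        smul_mem' := by
          rintro c a ⟨r, hr⟩
          exact ⟨c • r, fun x => by rw [smul_assoc, smul_assoc, hr]⟩ }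
    have hI : I = ⊤ := by
      rw [eq_top_iff, ← span_alternating h, Ideal.span_le]
      rintro _ ⟨α, v, rfl⟩
      refine ⟨lift α.toMultilinearMap ((t : TPow R A n) * tprod R v), fun x => ?_⟩
      have h1 := lift_mul_comm h α (exteriorPower.ιMulti R n (M := A)) (tprod R v)
        ((t : TPow R A n) * x)
      have h2 := lift_mul_comm h (twist h t α) (exteriorPower.ιMulti R n (M := A)) x (tprod R v)
      rw [lift_twist, lift_twist] at h2
      rw [lift.tprod] at h1
      exact h1.trans h2
    obtain ⟨r, hr⟩ := (hI ▸ Submodule.mem_top : (1 : R) ∈ I)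
    exact ⟨r, fun x => by rw [← hr x, one_smul]⟩
  · intro r s hr hs
    exact eq_of_smul_wedge h _ _ fun x => (hr x).symm.trans (hs x)

end Algebra

end Ferrand

section FerrandHom

variable {R : Type u} [CommRing R] {A : Type v} [CommRing A] [Algebra R A] {n : ℕ}

/-- The Ferrand homomorphism `(A^{⊗ n})^{S_n} → R` of an algebra `A` of rank `n`: symmetric
tensors act on `⋀^n A` through their action on `A^{⊗ n}` by multiplication, and
`ferrandHom h t` is the scalar by which `t` acts. -/
noncomputable def ferrandHom (h : IsLocallyFreeOfRank R A n) :
    fixedPower R A (⊤ : Subgroup (Equiv.Perm (Fin n))) →ₐ[R] R where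
  toFun t := (Ferrand.existsUnique_scalar h t).choose
  map_one' := (Ferrand.existsUnique_scalar h 1).unique
    (Ferrand.existsUnique_scalar h 1).choose_spec.1 (fun x => by simp)
  map_mul' s t := (Ferrand.existsUnique_scalar h (s * t)).unique
    (Ferrand.existsUnique_scalar h (s * t)).choose_spec.1 (fun x => by
      rw [mul_smul, ← (Ferrand.existsUnique_scalar h t).choose_spec.1,
        ← (Ferrand.existsUnique_scalar h s).choose_spec.1, Subalgebra.coe_mul, mul_assoc])
  map_zero' := (Ferrand.existsUnique_scalar h 0).unique
    (Ferrand.existsUnique_scalar h 0).choose_spec.1 (fun x => by simp)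
  map_add' s t := (Ferrand.existsUnique_scalar h (s + t)).unique
    (Ferrand.existsUnique_scalar h (s + t)).choose_spec.1 (fun x => by
      rw [add_smul, ← (Ferrand.existsUnique_scalar h t).choose_spec.1,
        ← (Ferrand.existsUnique_scalar h s).choose_spec.1, Subalgebra.coe_add, add_mul, map_add])
  commutes' r := (Ferrand.existsUnique_scalar h (algebraMap R _ r)).unique
    (Ferrand.existsUnique_scalar h (algebraMap R _ r)).choose_spec.1 (fun x => by
      rw [Subalgebra.coe_algebraMap, ← Algebra.smul_def, map_smul]; rfl)

/-- The defining property of the Ferrand homomorphism. -/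
theorem ferrandHom_spec (h : IsLocallyFreeOfRank R A n)
    (t : fixedPower R A (⊤ : Subgroup (Equiv.Perm (Fin n)))) (x : TPow R A n) :
    toWedge R A n ((t : TPow R A n) * x) = ferrandHom h t • toWedge R A n x :=
  (Ferrand.existsUnique_scalar h t).choose_spec.1 x

theorem ferrandHom_unique (h : IsLocallyFreeOfRank R A n)
    (t : fixedPower R A (⊤ : Subgroup (Equiv.Perm (Fin n)))) (r : R)
    (hr : ∀ x : TPow R A n, toWedge R A n ((t : TPow R A n) * x) = r • toWedge R A n x) :
    ferrandHom h t = r :=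
  (Ferrand.existsUnique_scalar h t).unique (ferrandHom_spec h t) hr

/-- The Ferrand homomorphism sends `a ⊗ ⋯ ⊗ a` to the norm of `a`, i.e. to the scalar `N(a)` with
`(a * a₁) ∧ ⋯ ∧ (a * aₙ) = N(a) • (a₁ ∧ ⋯ ∧ aₙ)`. -/
theorem ferrandHom_tprod (h : IsLocallyFreeOfRank R A n) (a : A)
    (t : fixedPower R A (⊤ : Subgroup (Equiv.Perm (Fin n))))
    (ht : (t : TPow R A n) = PiTensorProduct.tprod R (fun _ => a)) (v : Fin n → A) :
    exteriorPower.ιMulti R n (fun i => a * v i) =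
      ferrandHom h t • exteriorPower.ιMulti R n v := by
  have := ferrandHom_spec h t (PiTensorProduct.tprod R v)
  rw [ht, PiTensorProduct.tprod_mul_tprod] at this
  have h1 : ∀ w, toWedge R A n (PiTensorProduct.tprod R w) = exteriorPower.ιMulti R n w :=
    fun w => PiTensorProduct.lift.tprod _
  rw [h1, h1] at this
  exact this

/-- The canonical ring homomorphism `A^{⊗ n} → A'^{⊗ n}` for the base change `A' = S ⊗ A`, as a
homomorphism of `R`-algebras. -/
noncomputable def TPow.baseChange (S : Type*) [CommRing S] [Algebra R S] :
    TPow R A n →ₐ[R] TPow S (S ⊗[R] A) n :=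
  PiTensorProduct.liftAlgHom
    (((PiTensorProduct.tprod S : MultilinearMap S (fun _ : Fin n => S ⊗[R] A) _).restrictScalars
      R).compLinearMap fun _ => (Algebra.TensorProduct.includeRight.toLinearMap : A →ₗ[R] S ⊗[R] A))
    (by
      change PiTensorProduct.tprod S (fun _ => (1 : S ⊗[R] A)) = 1
      rfl)
    (fun x y => by
      change PiTensorProduct.tprod S (fun i => (1 : S) ⊗ₜ[R] (x i * y i)) =
        PiTensorProduct.tprod S (fun i => (1 : S) ⊗ₜ[R] x i) *
          PiTensorProduct.tprod S (fun i => (1 : S) ⊗ₜ[R] y i)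
      rw [PiTensorProduct.tprod_mul_tprod]
      congr 1; funext i; simp)

@[simp] theorem TPow.baseChange_tprod (S : Type*) [CommRing S] [Algebra R S] (a : Fin n → A) :
    TPow.baseChange S (PiTensorProduct.tprod R a) =
      PiTensorProduct.tprod S (fun i => (1 : S) ⊗ₜ[R] a i) :=
  PiTensorProduct.lift.tprod _

/-- The Ferrand homomorphisms commute with base change. -/
theorem ferrandHom_baseChange (h : IsLocallyFreeOfRank R A n) (S : Type*) [CommRing S] [Algebra R S]
    (h' : IsLocallyFreeOfRank S (S ⊗[R] A) n)
    (t : fixedPower R A (⊤ : Subgroup (Equiv.Perm (Fin n))))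
    (t' : fixedPower S (S ⊗[R] A) (⊤ : Subgroup (Equiv.Perm (Fin n))))
    (ht : (t' : TPow S (S ⊗[R] A) n) = TPow.baseChange S (t : TPow R A n)) :
    ferrandHom h' t' = algebraMap R S (ferrandHom h t) := by
  let ω : A [⋀^Fin n]→ₗ[R] ⋀[S]^n (S ⊗[R] A) :=
    { ((exteriorPower.ιMulti S n (M := S ⊗[R] A)).toMultilinearMap.restrictScalars
        R).compLinearMap fun _ =>
          (Algebra.TensorProduct.includeRight.toLinearMap : A →ₗ[R] S ⊗[R] A) with
      map_eq_zero_of_eq' := fun v i j hv hij =>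
        (exteriorPower.ιMulti S n (M := S ⊗[R] A)).map_eq_zero_of_eq _
          (congrArg (fun a => (1 : S) ⊗ₜ[R] a) hv) hij }
  have hω : ∀ x : TPow R A n, toWedge S (S ⊗[R] A) n (TPow.baseChange S x) =
      exteriorPower.alternatingMapLinearEquiv ω (toWedge R A n x) := by
    intro x
    have : ((toWedge S (S ⊗[R] A) n).restrictScalars R) ∘ₗ (TPow.baseChange S).toLinearMap =
        exteriorPower.alternatingMapLinearEquiv ω ∘ₗ toWedge R A n := by
      ext v
      simp [toWedge, ω]
    exact congr($this x)
  refine ferrandHom_unique h' t' _ fun x => ?_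
  have hspan : Submodule.span S (Set.range fun a : A => (1 : S) ⊗ₜ[R] a) = ⊤ := by
    have := Submodule.baseChange_span (A := S) (Set.univ : Set A) (R := R)
    rw [Submodule.span_univ, Submodule.baseChange_top, Set.image_univ] at this
    exact this.symm
  have hlin : toWedge S (S ⊗[R] A) n ∘ₗ LinearMap.mulLeft S (t' : TPow S (S ⊗[R] A) n) =
      algebraMap R S (ferrandHom h t) • toWedge S (S ⊗[R] A) n := by
    refine PiTensorProduct.ext_of_span_eq_top (g := fun _ (a : A) => (1 : S) ⊗ₜ[R] a)
      (fun _ => hspan) fun v => ?_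
    change toWedge S (S ⊗[R] A) n ((t' : TPow S (S ⊗[R] A) n) *
        PiTensorProduct.tprod S fun i => (1 : S) ⊗ₜ[R] v i) =
      algebraMap R S (ferrandHom h t) • toWedge S (S ⊗[R] A) n
        (PiTensorProduct.tprod S fun i => (1 : S) ⊗ₜ[R] v i)
    rw [← TPow.baseChange_tprod, ht, ← map_mul, hω, hω, ferrandHom_spec, map_smul]
    exact (algebraMap_smul S _ _).symm
  exact congr($hlin x)

end FerrandHom

/-- A closure datum for an `R`-algebra `A` of rank `n`: a subgroup `G` of `S_n` together with an
`R`-algebra homomorphism `(A^{⊗ n})^G → R` extending the Ferrand homomorphism. -/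
structure ClosureDatum (R : Type u) [CommRing R] (A : Type v) [CommRing A] [Algebra R A] (n : ℕ)
    (h : IsLocallyFreeOfRank R A n) where
  /-- The group. -/
  G : Subgroup (Equiv.Perm (Fin n))
  /-- The homomorphism. -/
  φ : fixedPower R A G →ₐ[R] R
  extends_ferrandHom : φ.comp (Subalgebra.inclusion (fixedPower_anti le_top)) = ferrandHom h

/-- The closure algebra `A^{⊗ n} / (α - φ(α) : α ∈ (A^{⊗ n})^G)`, i.e. `A^{⊗ n} ⊗ R` over
`(A^{⊗ n})^G`, where `(A^{⊗ n})^G` acts on `R` through `φ`. -/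
abbrev ClosureDatum.ClosureAlgebra {R : Type u} [CommRing R] {A : Type v} [CommRing A]
    [Algebra R A] {n : ℕ} {h : IsLocallyFreeOfRank R A n} (D : ClosureDatum R A n h) :
    Type (max u v) :=
  TPow R A n ⧸ Ideal.span
    {β : TPow R A n | ∃ α : fixedPower R A D.G,
      β = (α : TPow R A n) - algebraMap R (TPow R A n) (D.φ α)}

/-!
Write `T = A^{⊗ n}` and let `C = T / (α - φ(α))` be the closure algebra, on which `G` still acts.
The theorem says that `C` is a `G`-torsor over `R`; this is proved by a
Chase–Harrison–Rosenberg argument, without étale descent to the case of split `A`.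

*The action is free.* The separability idempotent of the étale algebra `A`, placed in the `i`-th
and `j`-th factors, gives an idempotent `e_{ij}` of `T` (`diagIdem`), the characteristic function of
the locus where the `i`-th and `j`-th coordinates agree. For `i ≠ j`, multiples of `e_{ij}` die in
`⋀^n A`: up to multiplication by `e_{ij}`, exchanging the two factors changes nothing. Hence the
`S_n`-invariant element `∏_{i ≠ j} (1 - e_{ij})` acts on `⋀^n A` as the identity, the Ferrand
homomorphism sends it to `1`, and therefore so does `φ`. It follows that `e_{ij}` becomes `δ_{ij}`
in `C` (`ClosureDatum.proj_diagIdem`). The product over the `n` factors of the separability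
idempotents of `A` is then an element of `C ⊗ C` that the Galois map `C ⊗ C → ∏_G C`,
`a ⊗ b ↦ (a * σ(b))_σ`, sends to `(δ_{σ,1})_σ` (`ClosureDatum.galoisMap_sepIdem`).

*The trace takes values in `R`.* The composite `T → T^G → R` of the trace and `φ` descends to `C`
(`ClosureDatum.exists_trace`). It is not needed that `R` is the full ring of invariants of `C`.

These two facts yield dual bases of `C` over `R` (`sum_mul_trace_eq`), so `C` is finite projective;
they also show that the Galois map is bijective, so `C` is unramified, hence étale. Finally, at any
prime of `R` that lies under a prime of `C`, the rank of `C` can be computed after base change to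
`C`, where it is `|G|`; and all primes of `R` lie under one of `C` because `T` is integral over
`T^G` (`ClosureDatum.comap_surjective`).
-/

/-! ### Free group actions with a trace form -/

section GaloisAlgebra

variable {R : Type*} [CommRing R] {C : Type*} [CommRing C] [Algebra R C]
  {G : Type*} [Group G]

/-- For an action `ρ` of `G` on the `R`-algebra `C`, the homomorphism of left `C`-algebras
`C ⊗ C → ∏_G C` sending `a ⊗ b` to `(a * σ(b))_σ`. -/
noncomputable def galoisMap (ρ : G →* (C →ₐ[R] C)) : C ⊗[R] C →ₐ[C] (G → C) :=
  AlgHom.pi fun σ => Algebra.TensorProduct.productLeftAlgHom (AlgHom.id C C) (ρ σ)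

@[simp] theorem galoisMap_tmul (ρ : G →* (C →ₐ[R] C)) (a b : C) (σ : G) :
    galoisMap ρ (a ⊗ₜ[R] b) σ = a * ρ σ b := by
  simp [galoisMap]

/-- If the Galois map hits the indicator function of `1 ∈ G`, it hits that of every `σ`, by the
action of `σ⁻¹` on the second tensor factor. -/
theorem galoisMap_surjective [Fintype G] [DecidableEq G] (ρ : G →* (C →ₐ[R] C)) (E : C ⊗[R] C)
    (hE : galoisMap ρ E = Pi.single 1 1) : Function.Surjective (galoisMap ρ) := by
  intro f
  have key : ∀ (σ τ : G) (z : C ⊗[R] C),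
      galoisMap ρ (Algebra.TensorProduct.map (AlgHom.id R C) (ρ σ⁻¹) z) τ =
        galoisMap ρ z (τ * σ⁻¹) := by
    intro σ τ z
    induction z with
    | zero => simp
    | add x y hx hy => simp only [map_add, Pi.add_apply, hx, hy]
    | tmul a b => simp [map_mul]
  refine ⟨∑ σ, f σ • Algebra.TensorProduct.map (AlgHom.id R C) (ρ σ⁻¹) E, ?_⟩
  ext τ
  simp only [map_sum, map_smul, Finset.sum_apply, Pi.smul_apply, key, hE, smul_eq_mul]
  rw [Finset.sum_eq_single τ]
  · simp
  · intro σ _ hσ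
    rw [Pi.single_eq_of_ne, mul_zero]
    rwa [Ne, mul_inv_eq_one, eq_comm]
  · simp

/-- Writing `E = ∑ xⱼ ⊗ yⱼ`, the `xⱼ` and the forms `c ↦ tr(yⱼ c)` are dual bases of `C`. -/
theorem sum_mul_trace_eq [Fintype G] [DecidableEq G] (ρ : G →* (C →ₐ[R] C)) (tr : C →ₗ[R] R)
    (htr : ∀ c, algebraMap R C (tr c) = ∑ σ, ρ σ c) {k : ℕ} (x y : Fin k → C)
    (hE : galoisMap ρ (∑ j, x j ⊗ₜ[R] y j) = Pi.single 1 1) (c : C) :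
    ∑ j, tr (y j * c) • x j = c := by
  have h (σ : G) : ∑ j, x j * ρ σ (y j) = (Pi.single 1 1 : G → C) σ := by
    rw [← hE]; simp
  simp only [Algebra.smul_def, htr, map_mul, Finset.sum_mul]
  rw [Finset.sum_comm]
  calc ∑ σ, ∑ j, ρ σ (y j) * ρ σ c * x j
      = ∑ σ, (∑ j, x j * ρ σ (y j)) * ρ σ c := by
        simp only [Finset.sum_mul]
        exact Finset.sum_congr rfl fun σ _ => Finset.sum_congr rfl fun j _ => by ring
    _ = c := by
        rw [Finset.sum_eq_single 1]
        · rw [h, Pi.single_eq_same, one_mul, map_one, AlgHom.one_apply]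
        · intro σ _ hσ; rw [h, Pi.single_eq_of_ne hσ, zero_mul]
        · simp

theorem finite_of_galoisMap_eq_single [Fintype G] [DecidableEq G] (ρ : G →* (C →ₐ[R] C))
    (tr : C →ₗ[R] R) (htr : ∀ c, algebraMap R C (tr c) = ∑ σ, ρ σ c) (E : C ⊗[R] C)
    (hE : galoisMap ρ E = Pi.single 1 1) : Module.Finite R C := by
  obtain ⟨k, x, y, rfl⟩ := TensorProduct.exists_sum_tmul_eq E
  refine Module.Finite.of_surjective (Fintype.linearCombination R x) fun c =>
    ⟨fun j => tr (y j * c), ?_⟩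
  rw [Fintype.linearCombination_apply]
  exact sum_mul_trace_eq ρ tr htr x y hE c

theorem projective_of_galoisMap_eq_single [Fintype G] [DecidableEq G] (ρ : G →* (C →ₐ[R] C))
    (tr : C →ₗ[R] R) (htr : ∀ c, algebraMap R C (tr c) = ∑ σ, ρ σ c) (E : C ⊗[R] C)
    (hE : galoisMap ρ E = Pi.single 1 1) : Module.Projective R C := by
  obtain ⟨k, x, y, rfl⟩ := TensorProduct.exists_sum_tmul_eq E
  refine Module.Projective.of_split (M := Fin k → R)
    (LinearMap.pi fun j => tr ∘ₗ LinearMap.mulLeft R (y j)) (Fintype.linearCombination R x) ?_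
  ext c
  simp only [LinearMap.comp_apply, Fintype.linearCombination_apply, LinearMap.pi_apply,
    LinearMap.mulLeft_apply, LinearMap.id_apply]
  exact sum_mul_trace_eq ρ tr htr x y hE c

/-- The expansion of the second tensor factor in the dual bases recovers a tensor from its image
under the Galois map. -/
theorem galoisMap_injective [Fintype G] [DecidableEq G] (ρ : G →* (C →ₐ[R] C))
    (tr : C →ₗ[R] R) (htr : ∀ c, algebraMap R C (tr c) = ∑ σ, ρ σ c) (E : C ⊗[R] C)
    (hE : galoisMap ρ E = Pi.single 1 1) : Function.Injective (galoisMap ρ) := by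
  obtain ⟨k, x, y, rfl⟩ := TensorProduct.exists_sum_tmul_eq E
  have key : ∀ z : C ⊗[R] C,
      ∑ j, (∑ σ, galoisMap ρ z σ * ρ σ (y j)) ⊗ₜ[R] x j = z := by
    intro z
    induction z with
    | zero => simp
    | add a b ha hb =>
      simp only [map_add, Pi.add_apply, add_mul, Finset.sum_add_distrib, TensorProduct.add_tmul,
        ha, hb]
    | tmul a b =>
      conv_rhs => rw [← sum_mul_trace_eq ρ tr htr x y hE b, TensorProduct.tmul_sum]
      refine Finset.sum_congr rfl fun j _ => ?_
      rw [TensorProduct.tmul_smul, TensorProduct.smul_tmul', Algebra.smul_def, htr,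
        Finset.sum_mul]
      congr 1
      refine Finset.sum_congr rfl fun σ _ => ?_
      rw [galoisMap_tmul, map_mul]; ring
  intro z w hzw
  rw [← key z, ← key w, hzw]

/-- A preimage `E` of the indicator function of `1 ∈ G` is a separability idempotent. -/
theorem formallyUnramified_of_galoisMap [DecidableEq G] [Module.Finite R C]
    (ρ : G →* (C →ₐ[R] C)) (hinj : Function.Injective (galoisMap ρ)) (E : C ⊗[R] C)
    (hE : galoisMap ρ E = Pi.single 1 1) : Algebra.FormallyUnramified R C := by
  refine Algebra.FormallyUnramified.iff_exists_tensorProduct.2 ⟨E, fun s => hinj ?_, ?_⟩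
  · rw [map_mul, map_zero, hE]
    ext σ
    by_cases hσ : σ = 1
    · subst hσ; simp
    · simp [hσ]
  · have h : ∀ z : C ⊗[R] C, Algebra.TensorProduct.lmul' R z = galoisMap ρ z 1 := by
      intro z
      induction z with
      | zero => simp
      | add x y hx hy => simp only [map_add, Pi.add_apply, hx, hy]
      | tmul a b => simp
    rw [h, hE, Pi.single_eq_same]

/-- The rank at `p` is computed after base change to `C`, at a prime over `p`, where
`C ⊗ C ≅ ∏_G C`. -/
theorem rankAtStalk_of_galoisMap_bijective [Finite G] [Module.Finite R C] [Module.Flat R C]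
    (ρ : G →* (C →ₐ[R] C)) (hbij : Function.Bijective (galoisMap ρ)) (p : PrimeSpectrum R)
    (hp : p ∈ Set.range (PrimeSpectrum.comap (algebraMap R C))) :
    Module.rankAtStalk C p = Nat.card G := by
  obtain ⟨q, rfl⟩ := hp
  have : Nontrivial C := q.nontrivial
  have := Fintype.ofFinite G
  rw [← Module.rankAtStalk_baseChange,
    Module.rankAtStalk_eq_of_equiv (LinearEquiv.ofBijective (galoisMap ρ).toLinearMap hbij),
    Module.rankAtStalk_eq_finrank_of_free]
  simp

end GaloisAlgebra

/-! ### Modules of constant rank -/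

theorem isLocallyFreeOfRank_of_rankAtStalk {R : Type*} [CommRing R] {M : Type*} [AddCommGroup M]
    [Module R M] [Module.Finite R M] [Module.Flat R M] {n : ℕ}
    (h : ∀ p : PrimeSpectrum R, Module.rankAtStalk M p = n) : IsLocallyFreeOfRank R M n := by
  by_contra hne
  obtain ⟨m, hm, hle⟩ := Ideal.exists_le_maximal _ hne
  obtain ⟨a, ha, hfree⟩ := Module.Free.away_of_finite_of_flat_of_rankAtStalk_constant M m
    fun m' _ => by rw [h, h]
  refine ha (hle (Ideal.subset_span ?_))
  have hnt : Nontrivial (Localization.Away a) := by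
    rw [← not_subsingleton_iff_nontrivial,
      IsLocalization.subsingleton_iff (M := Submonoid.powers a)]
    rintro ⟨k, hk⟩
    exact ha (hm.isPrime.mem_of_pow_mem k (by simp only at hk; rw [hk]; exact zero_mem m))
  obtain ⟨q⟩ : Nonempty (PrimeSpectrum (Localization.Away a)) := inferInstance
  have hr : Module.finrank (Localization.Away a) (LocalizedModule.Away a M) = n := by
    rw [← h (q.comap (algebraMap R _)), ← Module.rankAtStalk_isBaseChange
      (LocalizedModule.isBaseChange (Submonoid.powers a) M) q,
      Module.rankAtStalk_eq_finrank_of_free]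
    simp
  exact ⟨Module.finBasisOfFinrankEq _ _ hr⟩

/-! ### Permutations and the diagonal idempotents of a tensor power -/

section TPow

open PiTensorProduct

variable {R : Type*} [CommRing R] {A : Type*} [CommRing A] [Algebra R A] {n : ℕ}

/-- The action of the symmetric group on `A^{⊗ n}` as a homomorphism of monoids. -/
noncomputable def TPow.permuteHom (R : Type*) [CommRing R] (A : Type*) [CommRing A] [Algebra R A]
    (n : ℕ) : Equiv.Perm (Fin n) →* (TPow R A n →ₐ[R] TPow R A n) where
  toFun := TPow.permute
  map_one' := by
    apply AlgHom.toLinearMap_injective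
    ext v
    simp only [LinearMap.compMultilinearMap_apply, AlgHom.toLinearMap_apply, TPow.permute_tprod]
    rfl
  map_mul' σ τ := by
    apply AlgHom.toLinearMap_injective
    ext v
    simp only [LinearMap.compMultilinearMap_apply, AlgHom.toLinearMap_apply, AlgHom.mul_apply,
      TPow.permute_tprod]
    rfl

theorem TPow.permute_single (σ : Equiv.Perm (Fin n)) (i : Fin n) (a : A) :
    TPow.permute σ (singleAlgHom (R := R) (A := fun _ : Fin n => A) i a) =
      singleAlgHom (R := R) (A := fun _ : Fin n => A) (σ i) a := by
  simp only [singleAlgHom_apply, TPow.permute_tprod]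
  congr 1
  funext j
  by_cases hj : j = σ i
  · subst hj; simp
  · have : σ.symm j ≠ i := fun h => hj (by simp [← h])
    simp [hj, this]

variable [Algebra.Etale R A]

/-- The idempotent `e_{ij}` of `A^{⊗ n}` that cuts out the locus where the `i`-th and `j`-th
coordinates agree: the image, under the inclusion of the `i`-th and `j`-th factors, of the
separability idempotent of the étale algebra `A`. -/
noncomputable def diagIdem (R : Type*) [CommRing R] (A : Type*) [CommRing A] [Algebra R A]
    [Algebra.Etale R A] {n : ℕ} (i j : Fin n) : TPow R A n :=
  Algebra.TensorProduct.productMap (singleAlgHom (R := R) (A := fun _ : Fin n => A) i)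
    (singleAlgHom (R := R) (A := fun _ : Fin n => A) j) (Algebra.FormallyUnramified.elem R A)

theorem diagIdem_self (i : Fin n) : diagIdem R A i i = 1 := by
  have h : Algebra.TensorProduct.productMap (singleAlgHom (R := R) (A := fun _ : Fin n => A) i)
      (singleAlgHom (R := R) (A := fun _ : Fin n => A) i) =
      (singleAlgHom (R := R) (A := fun _ : Fin n => A) i).comp
        (Algebra.TensorProduct.lmul' R) := by
    ext <;> simp
  rw [diagIdem, h, AlgHom.comp_apply, Algebra.FormallyUnramified.lmul_elem, map_one]

theorem permute_diagIdem (σ : Equiv.Perm (Fin n)) (i j : Fin n) :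
    TPow.permute σ (diagIdem R A i j) = diagIdem R A (σ i) (σ j) := by
  have h : (TPow.permute σ).comp
      (Algebra.TensorProduct.productMap (singleAlgHom (R := R) (A := fun _ : Fin n => A) i)
        (singleAlgHom (R := R) (A := fun _ : Fin n => A) j)) =
      Algebra.TensorProduct.productMap (singleAlgHom (R := R) (A := fun _ : Fin n => A) (σ i))
        (singleAlgHom (R := R) (A := fun _ : Fin n => A) (σ j)) := by
    ext a
    · simpa using TPow.permute_single σ i a
    · simpa using TPow.permute_single σ j a
  exact congr($h _)

theorem diagIdem_mul_single (i j : Fin n) (a : A) :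
    diagIdem R A i j * singleAlgHom (R := R) (A := fun _ : Fin n => A) j a =
      diagIdem R A i j * singleAlgHom (R := R) (A := fun _ : Fin n => A) i a := by
  have h := congr(Algebra.TensorProduct.productMap
    (singleAlgHom (R := R) (A := fun _ : Fin n => A) i)
    (singleAlgHom (R := R) (A := fun _ : Fin n => A) j)
    $(Algebra.FormallyUnramified.one_tmul_sub_tmul_one_mul_elem (R := R) (S := A) a))
  rw [map_mul, map_sub, map_zero, Algebra.TensorProduct.productMap_apply_tmul,
    Algebra.TensorProduct.productMap_apply_tmul, map_one, map_one, one_mul, mul_one, sub_mul,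
    sub_eq_zero] at h
  rw [mul_comm, mul_comm (diagIdem R A i j)]
  exact h

/-- On the locus where the `i`-th and `j`-th coordinates agree, exchanging them does nothing. -/
theorem diagIdem_mul_permute_swap (i j : Fin n) (x : TPow R A n) :
    diagIdem R A i j * TPow.permute (Equiv.swap i j) x = diagIdem R A i j * x := by
  let J : Ideal (TPow R A n) := LinearMap.ker (LinearMap.mulLeft (TPow R A n) (diagIdem R A i j))
  have hJ : ∀ y z : TPow R A n, Ideal.Quotient.mkₐ R J y = Ideal.Quotient.mkₐ R J z ↔
      diagIdem R A i j * y = diagIdem R A i j * z := by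
    intro y z
    rw [Ideal.Quotient.mkₐ_eq_mk, Ideal.Quotient.mk_eq_mk_iff_sub_mem, LinearMap.mem_ker,
      LinearMap.mulLeft_apply, mul_sub, sub_eq_zero]
  have h : (Ideal.Quotient.mkₐ R J).comp (TPow.permute (Equiv.swap i j)) =
      Ideal.Quotient.mkₐ R J := by
    refine algHom_ext fun k => AlgHom.ext fun a => ?_
    simp only [AlgHom.comp_apply]
    rw [TPow.permute_single, hJ]
    by_cases hi : k = i
    · subst hi; rw [Equiv.swap_apply_left, diagIdem_mul_single]
    · by_cases hj : k = j
      · subst hj; rw [Equiv.swap_apply_right, diagIdem_mul_single]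
      · rw [Equiv.swap_apply_of_ne_of_ne hi hj]
  exact (hJ _ _).1 congr($h x)

theorem diagIdem_mul_self (i j : Fin n) :
    diagIdem R A i j * diagIdem R A i j = diagIdem R A i j := by
  have h : ∀ z : A ⊗[R] A, diagIdem R A i j * Algebra.TensorProduct.productMap
      (singleAlgHom (R := R) (A := fun _ : Fin n => A) i)
      (singleAlgHom (R := R) (A := fun _ : Fin n => A) j) z =
      diagIdem R A i j * singleAlgHom (R := R) (A := fun _ : Fin n => A) i
        (Algebra.TensorProduct.lmul' R z) := by
    intro z
    induction z with
    | zero => simp only [map_zero]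
    | add x y hx hy => simp only [map_add, mul_add, hx, hy]
    | tmul a b =>
      rw [Algebra.TensorProduct.productMap_apply_tmul, Algebra.TensorProduct.lmul'_apply_tmul,
        map_mul, mul_left_comm, diagIdem_mul_single, mul_left_comm]
  have h1 := h (Algebra.FormallyUnramified.elem R A)
  rw [Algebra.FormallyUnramified.lmul_elem, map_one, mul_one] at h1
  exact h1

theorem diagIdem_comm (i j : Fin n) : diagIdem R A i j = diagIdem R A j i := by
  have h (i j : Fin n) : diagIdem R A i j * diagIdem R A j i = diagIdem R A i j := by
    have h1 := diagIdem_mul_permute_swap i j (diagIdem R A i j)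
    rwa [permute_diagIdem, Equiv.swap_apply_left, Equiv.swap_apply_right, diagIdem_mul_self] at h1
  rw [← h i j, mul_comm, h j i]

/-- The tensor `e_{ij} * x` is fixed by the transposition of `i` and `j`, and alternating maps kill
such tensors. -/
theorem toWedge_diagIdem_mul (h : IsLocallyFreeOfRank R A n) {i j : Fin n} (hij : i ≠ j)
    (x : TPow R A n) : toWedge R A n (diagIdem R A i j * x) = 0 := by
  refine Ferrand.lift_eq_zero_of_swap h (exteriorPower.ιMulti R n (M := A)) hij _ ?_
  have h1 : TPow.permute (Equiv.swap i j) (diagIdem R A i j * x) = diagIdem R A i j * x := by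
    rw [map_mul, permute_diagIdem, Equiv.swap_apply_left, Equiv.swap_apply_right,
      diagIdem_comm j i, diagIdem_mul_permute_swap]
  exact h1

/-- The idempotent `∏_{i ≠ j} (1 - e_{ij})` of `A^{⊗ n}` that cuts out the locus where the
coordinates are pairwise distinct. -/
noncomputable def distinctIdem (R : Type*) [CommRing R] (A : Type*) [CommRing A] [Algebra R A]
    [Algebra.Etale R A] (n : ℕ) : TPow R A n :=
  ∏ i : Fin n, ∏ j : Fin n, if i = j then 1 else 1 - diagIdem R A i j

theorem permute_distinctIdem (σ : Equiv.Perm (Fin n)) :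
    TPow.permute σ (distinctIdem R A n) = distinctIdem R A n := by
  simp only [distinctIdem, map_prod, apply_ite (TPow.permute σ), map_sub, map_one,
    permute_diagIdem]
  rw [← Equiv.prod_comp σ (fun i => ∏ j, if i = j then (1 : TPow R A n) else 1 - diagIdem R A i j)]
  refine Finset.prod_congr rfl fun i _ => ?_
  rw [← Equiv.prod_comp σ (fun j => if σ i = j then (1 : TPow R A n) else 1 - diagIdem R A (σ i) j)]
  simp

theorem toWedge_distinctIdem_mul (h : IsLocallyFreeOfRank R A n) (x : TPow R A n) :
    toWedge R A n (distinctIdem R A n * x) = toWedge R A n x := by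
  let S : Submonoid (TPow R A n) :=
    { carrier := {t | ∀ x, toWedge R A n (t * x) = toWedge R A n x}
      one_mem' := fun x => by rw [one_mul]
      mul_mem' := fun {s t} hs ht x => by rw [mul_assoc, hs, ht] }
  refine (?_ : distinctIdem R A n ∈ S) x
  refine S.prod_mem fun i _ => S.prod_mem fun j _ => ?_
  split_ifs with hij
  · exact S.one_mem
  · intro y
    rw [sub_mul, one_mul, map_sub, toWedge_diagIdem_mul h hij, sub_zero]

theorem distinctIdem_mul_diagIdem {i j : Fin n} (hij : i ≠ j) :
    distinctIdem R A n * diagIdem R A i j = 0 := by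
  have h : 1 - diagIdem R A i j ∣ distinctIdem R A n := by
    have h1 := Finset.dvd_prod_of_mem
      (fun j : Fin n => if i = j then (1 : TPow R A n) else 1 - diagIdem R A i j)
      (Finset.mem_univ j)
    rw [if_neg hij] at h1
    exact h1.trans (Finset.dvd_prod_of_mem (fun i : Fin n => ∏ j : Fin n,
      if i = j then (1 : TPow R A n) else 1 - diagIdem R A i j) (Finset.mem_univ i))
  obtain ⟨c, hc⟩ := h
  rw [hc, mul_right_comm, sub_mul, one_mul, diagIdem_mul_self, sub_self, zero_mul]

end TPow

/-! ### The closure algebra -/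

namespace ClosureDatum

open PiTensorProduct

variable {R : Type*} [CommRing R] {A : Type*} [CommRing A] [Algebra R A] {n : ℕ}
  {h : IsLocallyFreeOfRank R A n} (D : ClosureDatum R A n h)

/-- The quotient map from `A^{⊗ n}` to the closure algebra. -/
noncomputable def proj : TPow R A n →ₐ[R] D.ClosureAlgebra := Ideal.Quotient.mkₐ R _

theorem proj_surjective : Function.Surjective D.proj := Ideal.Quotient.mkₐ_surjective R _

theorem proj_fixedPower (α : fixedPower R A D.G) :
    D.proj (α : TPow R A n) = algebraMap R D.ClosureAlgebra (D.φ α) := by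
  rw [← D.proj.commutes]
  exact (Ideal.Quotient.mk_eq_mk_iff_sub_mem _ _).2 (Ideal.subset_span ⟨α, rfl⟩)

/-- The action of `G` on the closure algebra induced by the permutation of tensor factors. -/
noncomputable def action : D.G →* (D.ClosureAlgebra →ₐ[R] D.ClosureAlgebra) where
  toFun σ := Ideal.Quotient.liftₐ _ (D.proj.comp (TPow.permute (σ : Equiv.Perm (Fin n)))) (by
    intro a ha
    refine (Ideal.span_le (I := RingHom.ker
      (D.proj.comp (TPow.permute (σ : Equiv.Perm (Fin n)))))).2 ?_ ha
    rintro _ ⟨α, rfl⟩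
    rw [SetLike.mem_coe, RingHom.mem_ker, map_sub, AlgHom.commutes, AlgHom.comp_apply,
      α.2 _ σ.2, proj_fixedPower, sub_self])
  map_one' := by
    refine AlgHom.ext fun c => ?_
    obtain ⟨t, rfl⟩ := D.proj_surjective c
    exact congr(D.proj ($((TPow.permuteHom R A n).map_one) t))
  map_mul' σ τ := by
    refine AlgHom.ext fun c => ?_
    obtain ⟨t, rfl⟩ := D.proj_surjective c
    exact congr(D.proj ($((TPow.permuteHom R A n).map_mul σ τ) t))

theorem action_proj (σ : D.G) (t : TPow R A n) :
    D.action σ (D.proj t) = D.proj (TPow.permute (σ : Equiv.Perm (Fin n)) t) := rfl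

/-- The trace `A^{⊗ n} → (A^{⊗ n})^G` for the action of `G`. -/
noncomputable def powTrace (R : Type*) [CommRing R] (A : Type*) [CommRing A] [Algebra R A] {n : ℕ}
    (G : Subgroup (Equiv.Perm (Fin n))) [Fintype G] : TPow R A n →ₗ[R] fixedPower R A G :=
  LinearMap.codRestrict (Subalgebra.toSubmodule (fixedPower R A G))
    (∑ σ : G, (TPow.permute (σ : Equiv.Perm (Fin n))).toLinearMap) fun t τ hτ => by
      simp only [LinearMap.sum_apply, AlgHom.toLinearMap_apply, map_sum]
      conv_rhs => rw [← Equiv.sum_comp (Equiv.mulLeft (⟨τ, hτ⟩ : G))]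
      refine Finset.sum_congr rfl fun σ _ => ?_
      exact congr($((TPow.permuteHom R A n).map_mul τ σ) t).symm

theorem coe_powTrace (G : Subgroup (Equiv.Perm (Fin n))) [Fintype G] (t : TPow R A n) :
    (powTrace R A G t : TPow R A n) = ∑ σ : G, TPow.permute (σ : Equiv.Perm (Fin n)) t := by
  refine (LinearMap.codRestrict_apply (Subalgebra.toSubmodule (fixedPower R A G)) _ t).trans ?_
  simp only [LinearMap.sum_apply, AlgHom.toLinearMap_apply]

theorem powTrace_mul (G : Subgroup (Equiv.Perm (Fin n))) [Fintype G] (α : fixedPower R A G)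
    (t : TPow R A n) : powTrace R A G ((α : TPow R A n) * t) = α * powTrace R A G t := by
  ext
  rw [Subalgebra.coe_mul, coe_powTrace, coe_powTrace, Finset.mul_sum]
  refine Finset.sum_congr rfl fun σ _ => ?_
  rw [map_mul, α.2 _ σ.2]

/-- The trace of the action of `G` on the closure algebra has a lift to `R`, induced by the
composite of `φ` with the trace of `A^{⊗ n}`. -/
theorem exists_trace [Fintype D.G] : ∃ tr : D.ClosureAlgebra →ₗ[R] R,
    ∀ c, algebraMap R D.ClosureAlgebra (tr c) = ∑ σ, D.action σ c := by
  let f : TPow R A n →ₗ[R] R := D.φ.toLinearMap ∘ₗ powTrace R A D.G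
  let K : Ideal (TPow R A n) :=
    { carrier := {t | ∀ s, f (t * s) = 0}
      zero_mem' := fun s => by rw [zero_mul, map_zero]
      add_mem' := fun {a b} ha hb s => by rw [add_mul, map_add, ha, hb, add_zero]
      smul_mem' := fun c t ht s => by rw [smul_eq_mul, mul_comm c, mul_assoc, ht] }
  have hK : Ideal.span {β : TPow R A n | ∃ α : fixedPower R A D.G,
      β = (α : TPow R A n) - algebraMap R (TPow R A n) (D.φ α)} ≤ K := by
    rw [Ideal.span_le]
    rintro _ ⟨α, rfl⟩ s
    simp only [f, sub_mul, map_sub, LinearMap.comp_apply, powTrace_mul, AlgHom.toLinearMap_apply,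
      map_mul, ← Algebra.smul_def, map_smul, smul_eq_mul, sub_self]
  let tr : D.ClosureAlgebra →ₗ[R] R := Submodule.liftQ (Submodule.restrictScalars R (Ideal.span
      {β : TPow R A n | ∃ α : fixedPower R A D.G,
        β = (α : TPow R A n) - algebraMap R (TPow R A n) (D.φ α)})) f
      (fun t ht => by simpa using hK ht 1) ∘ₗ
    (Submodule.Quotient.restrictScalarsEquiv R _).symm.toLinearMap
  refine ⟨tr, fun c => ?_⟩
  obtain ⟨t, rfl⟩ := D.proj_surjective c
  have h1 : tr (D.proj t) = D.φ (powTrace R A D.G t) := rfl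
  rw [h1, ← proj_fixedPower, coe_powTrace, map_sum]
  rfl

/-- Every prime of `R` lies under a prime of the closure algebra: `A^{⊗ n}` is integral over its
`G`-invariants, so there is a prime over `φ⁻¹(p)`, and it contains the relations. -/
theorem comap_surjective :
    Function.Surjective (PrimeSpectrum.comap (algebraMap R D.ClosureAlgebra)) := by
  intro p
  have hint : Algebra.IsIntegral (fixedPower R A D.G) (TPow R A n) := by
    let ψ : D.G →* (TPow R A n →+* TPow R A n) :=
      { toFun := fun σ => (TPow.permute (σ : Equiv.Perm (Fin n)) :
          TPow R A n →ₐ[R] TPow R A n).toRingHom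
        map_one' := congrArg AlgHom.toRingHom (TPow.permuteHom R A n).map_one
        map_mul' := fun σ τ => congrArg AlgHom.toRingHom ((TPow.permuteHom R A n).map_mul σ τ) }
    let : MulSemiringAction D.G (TPow R A n) := MulSemiringAction.compHom _ ψ
    have : Algebra.IsInvariant (fixedPower R A D.G) (TPow R A n) D.G :=
      ⟨fun b hb => ⟨⟨b, fun σ hσ => hb ⟨σ, hσ⟩⟩, rfl⟩⟩
    exact Algebra.IsInvariant.isIntegral _ _ D.G
  let P : Ideal (fixedPower R A D.G) := p.asIdeal.comap D.φ
  have hP : P.IsPrime := Ideal.comap_isPrime D.φ p.asIdeal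
  let J : Ideal (TPow R A n) := Ideal.span {β : TPow R A n | ∃ α : fixedPower R A D.G,
    β = (α : TPow R A n) - algebraMap R (TPow R A n) (D.φ α)}
  obtain ⟨Q, -, hQ, hQP⟩ := Ideal.exists_ideal_over_prime_of_isIntegral P (⊥ : Ideal (TPow R A n))
    (by
      intro α hα
      have : (α : TPow R A n) = 0 := hα
      have : α = 0 := Subtype.ext this
      rw [this]; exact zero_mem P)
  have hmem : ∀ α : fixedPower R A D.G, (α : TPow R A n) ∈ Q ↔ D.φ α ∈ p.asIdeal := by
    intro α
    have : α ∈ Q.comap (algebraMap (fixedPower R A D.G) (TPow R A n)) ↔ α ∈ P := by rw [hQP]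
    exact this
  have hJQ : J ≤ Q := by
    rw [Ideal.span_le]
    rintro _ ⟨α, rfl⟩
    have := (hmem (α - algebraMap R _ (D.φ α))).2 (by
      rw [map_sub, AlgHom.commutes]; simp)
    simpa using this
  have hker : RingHom.ker (Ideal.Quotient.mk J) ≤ Q := by rwa [Ideal.mk_ker]
  have hQ' : (Q.map (Ideal.Quotient.mk J)).IsPrime :=
    Ideal.map_isPrime_of_surjective Ideal.Quotient.mk_surjective hker
  refine ⟨⟨Q.map (Ideal.Quotient.mk J), hQ'⟩, ?_⟩
  ext r
  have h1 : algebraMap R D.ClosureAlgebra r = Ideal.Quotient.mk J (algebraMap R _ r) := rfl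
  have h2 : (Q.map (Ideal.Quotient.mk J)).comap (Ideal.Quotient.mk J) = Q := by
    rw [Ideal.comap_map_of_surjective' _ Ideal.Quotient.mk_surjective, sup_eq_left.2 hker]
  have h3 := hmem (algebraMap R _ r)
  rw [AlgHom.commutes] at h3
  rw [PrimeSpectrum.comap_asIdeal, Ideal.mem_comap, h1, ← Ideal.mem_comap, h2]
  exact h3

variable [Algebra.Etale R A]

theorem proj_distinctIdem : D.proj (distinctIdem R A n) = 1 := by
  let ε : fixedPower R A (⊤ : Subgroup (Equiv.Perm (Fin n))) :=
    ⟨distinctIdem R A n, fun σ _ => permute_distinctIdem σ⟩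
  have h1 : ferrandHom h ε = 1 := ferrandHom_unique h ε 1 fun x => by
    rw [one_smul, toWedge_distinctIdem_mul h]
  have h2 : D.φ (Subalgebra.inclusion (fixedPower_anti le_top) ε) = 1 := by
    rw [← h1, ← D.extends_ferrandHom]; rfl
  have h3 := D.proj_fixedPower (Subalgebra.inclusion (fixedPower_anti le_top) ε)
  rw [h2, map_one] at h3
  exact h3

theorem proj_diagIdem (i j : Fin n) :
    D.proj (diagIdem R A i j) = if i = j then 1 else 0 := by
  split_ifs with hij
  · rw [hij, diagIdem_self, map_one]
  · rw [← one_mul (D.proj _), ← D.proj_distinctIdem, ← map_mul, distinctIdem_mul_diagIdem hij,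
      map_zero]

/-- The separability idempotent of the closure algebra: the product of the separability idempotents
of the `n` tensor factors. -/
noncomputable def sepIdem : D.ClosureAlgebra ⊗[R] D.ClosureAlgebra :=
  ∏ i : Fin n, Algebra.TensorProduct.map
    (D.proj.comp (singleAlgHom (R := R) (A := fun _ : Fin n => A) i))
    (D.proj.comp (singleAlgHom (R := R) (A := fun _ : Fin n => A) i))
    (Algebra.FormallyUnramified.elem R A)

/-- The `σ`-component of the image of the separability idempotent is `∏ i, e_{i, σ i}`, and
`e_{ij}` maps to `δ_{ij}` in the closure algebra. -/
theorem galoisMap_sepIdem [DecidableEq D.G] :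
    galoisMap D.action D.sepIdem = Pi.single 1 1 := by
  have key : ∀ (σ : D.G) (i : Fin n) (z : A ⊗[R] A),
      galoisMap D.action (Algebra.TensorProduct.map
        (D.proj.comp (singleAlgHom (R := R) (A := fun _ : Fin n => A) i))
        (D.proj.comp (singleAlgHom (R := R) (A := fun _ : Fin n => A) i)) z) σ =
      D.proj (Algebra.TensorProduct.productMap
        (singleAlgHom (R := R) (A := fun _ : Fin n => A) i)
        (singleAlgHom (R := R) (A := fun _ : Fin n => A) ((σ : Equiv.Perm (Fin n)) i)) z) := by
    intro σ i z
    induction z with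
    | zero => simp only [map_zero, Pi.zero_apply]
    | add x y hx hy => simp only [map_add, Pi.add_apply, hx, hy]
    | tmul a b =>
      rw [Algebra.TensorProduct.map_tmul, galoisMap_tmul,
        Algebra.TensorProduct.productMap_apply_tmul, AlgHom.comp_apply, AlgHom.comp_apply,
        action_proj, TPow.permute_single, map_mul]
  ext σ
  rw [sepIdem, map_prod, Finset.prod_apply]
  simp only [key]
  change ∏ i, D.proj (diagIdem R A i ((σ : Equiv.Perm (Fin n)) i)) = _
  simp only [proj_diagIdem]
  by_cases hσ : σ = 1
  · subst hσ; simp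
  · rw [Pi.single_eq_of_ne hσ]
    obtain ⟨i, hi⟩ : ∃ i, (σ : Equiv.Perm (Fin n)) i ≠ i := by
      by_contra! hc
      exact hσ (Subtype.ext (Equiv.ext hc))
    exact Finset.prod_eq_zero (Finset.mem_univ i) (if_neg hi.symm)

end ClosureDatum

theorem mainTheorem9 (R : Type u) [CommRing R] (A : Type v) [CommRing A] [Algebra R A] (n : ℕ)
    (hA : IsLocallyFreeOfRank R A n) [Algebra.Etale R A] (D : ClosureDatum R A n hA) :
    IsLocallyFreeOfRank R D.ClosureAlgebra (Nat.card D.G) ∧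
      Algebra.Etale R D.ClosureAlgebra := by
  classical
  have := Fintype.ofFinite D.G
  obtain ⟨tr, htr⟩ := D.exists_trace
  have hE := D.galoisMap_sepIdem
  have := finite_of_galoisMap_eq_single D.action tr htr _ hE
  have := projective_of_galoisMap_eq_single D.action tr htr _ hE
  have hinj := galoisMap_injective D.action tr htr _ hE
  have := formallyUnramified_of_galoisMap D.action hinj _ hE
  refine ⟨isLocallyFreeOfRank_of_rankAtStalk fun p => ?_, ?_⟩
  · exact rankAtStalk_of_galoisMap_bijective D.action
      ⟨hinj, galoisMap_surjective D.action _ hE⟩ p (D.comap_surjective p)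
  · have := Module.finitePresentation_of_projective R D.ClosureAlgebra
    exact Algebra.Etale.of_formallyUnramified_of_flat
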